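/- Let $\mathcal S:\mathbb C\cup\{\infty\}\to\mathbb S^2\subset\mathbb R^3$ be the inverse stereographic projection $$\mathcal S(z)=\Big(\frac{2x}{1+|z|^2},\ \frac{2y}{1+|z|^2},\ \frac{|z|^2-1}{|z|^2+1}\Big)\quad(z=x+iy\in\mathbb C),\qquad \mathcal S(\infty)=N=(0,0,1).$$ For a complex rational function $f$, written as a reduced fraction, let $\mathcal S(f):\mathbb R^2=\mathbb C\to\mathbb S^2$ be the map $z\mapsto\mathcal S(f(z))$, where $f(z)=\infty$ (so that $\mathcal S(f)(z)=N$) at the poles $z$ of $f$. For a $C^1$ map $u:\mathbb R^2\to\mathbb S^2$ for which the integrand is integrable, put $$\deg(u)=\frac1{4\pi}\int_{\mathbb R^2}u\cdot(u_y\times u_x)\,dx\,dy .$$ The order of a polynomial is its degree, and the zero polynomial is given order $0$. (1) Let $g$, $p\neq0$ and $q$ be complex polynomials of orders $s$, $l$ and $t$ respectively, with $l<t$ and with $p/q$ irreducible (that is, $p$ and $q$ coprime), and let $u=\mathcal S\big(g+\frac pq\big)$. Then $u$ is of class $C^1$, the integrand $u\cdot(u_y\times u_x)$ is integrable on $\mathbb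 R^2$, and $\deg(u)=s+t$. (2) Let $q$ and $p\ne0$ be coprime complex polynomials, and let $u=\mathcal S(q/p)$. Then $u$ is of class $C^1$, the integrand $u\cdot(u_y\times u_x)$ is integrable on $\mathbb R^2$, and $\deg(u)=\max\{\text{order of }q,\ \text{order of }p\}$. -/

import Mathlib

open MeasureTheory Polynomial

noncomputable section

namespace SphereMap

/-- The unit sphere `𝕊²` in Euclidean space `ℝ³`. -/
abbrev S2 : Type := Metric.sphere (0 : EuclideanSpace ℝ (Fin 3)) 1

/-- The inverse stereographic projection from the north pole, in coordinates:
`(2x / (1 + |z|²), 2y / (1 + |z|²), (|z|² - 1) / (|z|² + 1))` for `z = x + i y`. -/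
def stereoVec (z : ℂ) : EuclideanSpace ℝ (Fin 3) :=
  !₂[2 * z.re / (1 + ‖z‖ ^ 2), 2 * z.im / (1 + ‖z‖ ^ 2), (‖z‖ ^ 2 - 1) / (‖z‖ ^ 2 + 1)]

/-- The north pole `N = (0, 0, 1)`, as a vector. -/
def northVec : EuclideanSpace ℝ (Fin 3) := !₂[0, 0, 1]

theorem stereoVec_mem (z : ℂ) :
    stereoVec z ∈ Metric.sphere (0 : EuclideanSpace ℝ (Fin 3)) 1 := by
  have h : (1 + ‖z‖ ^ 2 : ℝ) ≠ 0 := by positivity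
  have h2 : (‖z‖ ^ 2 + 1 : ℝ) ≠ 0 := by positivity
  have hz : ‖z‖ ^ 2 = z.re ^ 2 + z.im ^ 2 := by
    rw [Complex.sq_norm, Complex.normSq_apply]; ring
  rw [mem_sphere_zero_iff_norm, EuclideanSpace.norm_eq, Real.sqrt_eq_one, Fin.sum_univ_three]
  simp only [stereoVec, Real.norm_eq_abs, sq_abs, Matrix.cons_val_zero, Matrix.cons_val_one,
    Matrix.cons_val]
  field_simp
  rw [hz]
  ring

theorem northVec_mem : northVec ∈ Metric.sphere (0 : EuclideanSpace ℝ (Fin 3)) 1 := by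
  rw [mem_sphere_zero_iff_norm, EuclideanSpace.norm_eq, Real.sqrt_eq_one, Fin.sum_univ_three]
  simp [northVec]

/-- The map `𝒮`, on the whole Riemann sphere `ℂ ∪ {∞}`: it is the inverse stereographic
projection on `ℂ`, and it sends `∞` to the north pole. -/
def stereo : OnePoint ℂ → S2
  | none => ⟨northVec, northVec_mem⟩
  | some z => ⟨stereoVec z, stereoVec_mem z⟩

/-- The value in `ℂ ∪ {∞}` of a rational function at `z ∈ ℂ`; it is `∞` exactly at the poles
(numerator and denominator are those of the reduced fraction). -/
def ratValue (f : RatFunc ℂ) (z : ℂ) : OnePoint ℂ :=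
  open Classical in
  if f.denom.eval z = 0 then OnePoint.infty
  else ((f.num.eval z / f.denom.eval z : ℂ) : OnePoint ℂ)

/-- The map `𝒮(f) : ℝ² = ℂ → 𝕊²` given by a rational function `f`. -/
def ofRat (f : RatFunc ℂ) (z : ℂ) : S2 := stereo (ratValue f z)

/-- The map `u : ℝ² → 𝕊²`, viewed as a map into `ℝ³`. -/
def toVec (u : ℂ → S2) (z : ℂ) : EuclideanSpace ℝ (Fin 3) := (u z : EuclideanSpace ℝ (Fin 3))

/-- The partial derivative `u_x`. -/
def derivX (u : ℂ → S2) (z : ℂ) : EuclideanSpace ℝ (Fin 3) := fderiv ℝ (toVec u) z 1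

/-- The partial derivative `u_y`. -/
def derivY (u : ℂ → S2) (z : ℂ) : EuclideanSpace ℝ (Fin 3) := fderiv ℝ (toVec u) z Complex.I

/-- The function `u · (u_y × u_x)`. -/
def degreeDensity (u : ℂ → S2) (z : ℂ) : ℝ :=
  (toVec u z).ofLp ⬝ᵥ crossProduct (derivY u z).ofLp (derivX u z).ofLp

/-- The de Rham degree `(1 / 4π) ∫_{ℝ²} u · (u_y × u_x)` of a `C¹` map `u : ℝ² → 𝕊²`
(meaningful when the integrand is integrable). -/
def degree (u : ℂ → S2) : ℝ := 1 / (4 * Real.pi) * ∫ z : ℂ, degreeDensity u z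

end SphereMap

end

/-! Write the rational function as a reduced fraction P/Q. Off the poles its composite with `stereo`
has density 4|f'|²/(1+|f|²)², the pullback of the spherical area form. So the integral is the area
of the sphere, 4π, times the number of preimages of a generic w
(`lintegral_comp_mul_sq_norm_deriv`). That number is max(deg P, deg Q), since P - wQ has this degree
and simple roots for all but finitely many w (`Polynomial.ae_exists_card_fiber`). The density is
nonnegative, so finiteness of its lower integral also gives integrability.

Both claims are instances: g + p/q = (gq + p)/q is again reduced. -/

/-! ### Change of variables with multiplicity -/

/-- A function which is locally injective near the points of `U` is injective on each piece of a
countable measurable partition of `U`. -/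
theorem exists_disjoint_injOn_cover {α β : Type*} [TopologicalSpace α]
    [SecondCountableTopology α] [MeasurableSpace α] [BorelSpace α] [Nonempty α]
    {f : α → β} {U : Set α} (hU : MeasurableSet U)
    (h : ∀ z ∈ U, ∃ V : Set α, IsOpen V ∧ z ∈ V ∧ Set.InjOn f V) :
    ∃ A : ℕ → Set α, (∀ n, MeasurableSet (A n)) ∧ (∀ n, Set.InjOn f (A n)) ∧
      Pairwise (fun i j => Disjoint (A i) (A j)) ∧ ⋃ n, A n = U := by
  have h' : ∀ z, ∃ V : Set α, IsOpen V ∧ Set.InjOn f V ∧ (z ∈ U → z ∈ V) := by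
    intro z
    by_cases hz : z ∈ U
    · obtain ⟨V, h1, h2, h3⟩ := h z hz
      exact ⟨V, h1, h3, fun _ => h2⟩
    · exact ⟨∅, isOpen_empty, by simp, fun h => absurd h hz⟩
  choose V hVo hVi hVm using h'
  obtain ⟨t, -, htc, hUt⟩ := TopologicalSpace.countable_cover_nhdsWithin (f := V) (s := U)
    fun z hz => mem_nhdsWithin_of_mem_nhds ((hVo z).mem_nhds (hVm z hz))
  -- The extra point makes the countable index set nonempty, hence the range of a sequence.
  obtain ⟨e, he⟩ := (htc.insert (Classical.arbitrary α)).exists_eq_range (Set.insert_nonempty _ _)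
  refine ⟨fun n => U ∩ disjointed (V ∘ e) n,
    fun n => hU.inter (MeasurableSet.disjointed (fun i => (hVo _).measurableSet) n),
    fun n => (hVi (e n)).mono (Set.inter_subset_right.trans (disjointed_le (V ∘ e) n)),
    fun i j hij => (disjoint_disjointed (V ∘ e) hij).mono Set.inter_subset_right
      Set.inter_subset_right, ?_⟩
  rw [← Set.inter_iUnion, iUnion_disjointed, Set.inter_eq_left]
  intro z hz
  obtain ⟨x, hx, hzx⟩ := Set.mem_iUnion₂.1 (hUt hz)
  obtain ⟨n, rfl⟩ : x ∈ Set.range e := he ▸ Set.mem_insert_of_mem _ hx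
  exact Set.mem_iUnion.2 ⟨n, hzx⟩

/-- The determinant of multiplication by c is the algebra norm of c over ℝ. -/
theorem Complex.det_restrictScalars_toSpanSingleton (c : ℂ) :
    ((ContinuousLinearMap.toSpanSingleton ℂ c).restrictScalars ℝ).det = ‖c‖ ^ 2 := by
  have h : ((ContinuousLinearMap.toSpanSingleton ℂ c).restrictScalars ℝ : ℂ →ₗ[ℝ] ℂ) =
      Algebra.lmul ℝ ℂ c := by
    ext : 1
    simp [mul_comm]
  rw [ContinuousLinearMap.det, h, ← Algebra.norm_apply, Algebra.norm_complex_apply,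
    Complex.sq_norm]

/-- Change of variables for a holomorphic map, almost all of whose fibres have `d` points. -/
theorem lintegral_comp_mul_sq_norm_deriv {f f' : ℂ → ℂ} {U : Set ℂ} (hU : MeasurableSet U)
    (hf : ∀ z ∈ U, HasStrictDerivAt f (f' z) z) (hf' : ∀ z ∈ U, f' z ≠ 0)
    {g : ℂ → ENNReal} (hg : Measurable g) (d : ℕ)
    (hcount : ∀ᵐ w : ℂ, ∃ F : Finset ℂ, F.card = d ∧ ∀ z, z ∈ F ↔ z ∈ U ∧ f z = w) :
    ∫⁻ z in U, ENNReal.ofReal (‖f' z‖ ^ 2) * g (f z) = d * ∫⁻ w, g w := by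
  classical
  obtain ⟨A, hAm, hAi, hAd, hAU⟩ := exists_disjoint_injOn_cover (f := f) hU (fun z hz => by
    let e := ((hf z hz).hasStrictFDerivAt_equiv (hf' z hz)).toOpenPartialHomeomorph f
    exact ⟨e.source, e.open_source,
      ((hf z hz).hasStrictFDerivAt_equiv (hf' z hz)).mem_toOpenPartialHomeomorph_source,
      e.injOn⟩)
  have hAsub : ∀ n, A n ⊆ U := fun n => hAU ▸ Set.subset_iUnion A n
  have hfd : ∀ n, ∀ z ∈ A n, HasFDerivWithinAt f
      ((ContinuousLinearMap.toSpanSingleton ℂ (f' z)).restrictScalars ℝ) (A n) z := fun n z hz =>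
    ((hf z (hAsub n hz)).hasDerivAt.hasFDerivAt.restrictScalars ℝ).hasFDerivWithinAt
  have hpiece : ∀ n, ∫⁻ z in A n, ENNReal.ofReal (‖f' z‖ ^ 2) * g (f z) =
      ∫⁻ w, (f '' A n).indicator g w := by
    intro n
    rw [lintegral_indicator (measurable_image_of_fderivWithin (hAm n) (hfd n) (hAi n)),
      lintegral_image_eq_lintegral_abs_det_fderiv_mul volume (hAm n) (hfd n) (hAi n)]
    simp only [Complex.det_restrictScalars_toSpanSingleton, abs_pow, abs_norm]
  rw [← hAU, lintegral_iUnion hAm hAd]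
  simp_rw [hpiece]
  rw [← lintegral_tsum fun n => (hg.indicator
    (measurable_image_of_fderivWithin (hAm n) (hfd n) (hAi n))).aemeasurable,
    ← lintegral_const_mul _ hg]
  refine lintegral_congr_ae (hcount.mono ?_)
  rintro w ⟨F, hFd, hF⟩
  -- The images of the pieces may overlap. Each point of the fibre over w lies in exactly one piece,
  -- and each piece contains at most one, so the indicators of the images sum to the size of the
  -- fibre.
  have h1 : ∀ n, (f '' A n).indicator g w = ∑ z ∈ F, (A n).indicator (fun _ => g w) z := by
    intro n
    by_cases hw : w ∈ f '' A n
    · obtain ⟨z, hz, rfl⟩ := hw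
      rw [Set.indicator_of_mem (Set.mem_image_of_mem f hz),
        Finset.sum_eq_single_of_mem z ((hF z).2 ⟨hAsub n hz, rfl⟩),
        Set.indicator_of_mem hz]
      intro b hb hbz
      exact Set.indicator_of_notMem (fun hbA => hbz (hAi n hbA hz ((hF b).1 hb).2)) _
    · rw [Set.indicator_of_notMem hw, Finset.sum_eq_zero]
      intro b hb
      exact Set.indicator_of_notMem (fun hbA => hw ⟨b, hbA, ((hF b).1 hb).2⟩) _
  have h2 : ∀ z ∈ F, ∑' n, (A n).indicator (fun _ => g w) z = g w := by
    intro z hz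
    have hzU := ((hF z).1 hz).1
    obtain ⟨n, hn⟩ := Set.mem_iUnion.1 (hAU ▸ hzU)
    rw [tsum_eq_single n, Set.indicator_of_mem hn]
    intro m hm
    exact Set.indicator_of_notMem (fun hmz => Set.disjoint_left.1 (hAd hm) hmz hn) _
  simp_rw [h1]
  rw [Summable.tsum_finsetSum fun _ _ => ENNReal.summable, Finset.sum_congr rfl h2]
  simp [hFd]

/-! ### Area of the sphere in the plane chart -/

/-- A primitive of the radial integrand in polar coordinates. It rises from -2 at 0 to 0 at
infinity, and 2π · 2 = 4π. -/
theorem hasDerivAt_neg_inv_one_add_sq (y : ℝ) :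
    HasDerivAt (fun y : ℝ => -(2 / (1 + y ^ 2))) (y * (4 / (1 + y ^ 2) ^ 2)) y := by
  have h : (1 + y ^ 2) ≠ 0 := by positivity
  convert! (((hasDerivAt_const y (2 : ℝ)).div (((hasDerivAt_pow 2 y).const_add 1)) h)).neg using 1
  field_simp
  ring

theorem tendsto_neg_inv_one_add_sq :
    Filter.Tendsto (fun y : ℝ => -(2 / (1 + y ^ 2))) Filter.atTop (nhds 0) := by
  rw [← neg_zero]
  refine Filter.Tendsto.neg (Filter.Tendsto.const_div_atTop ?_ 2)
  exact Filter.tendsto_atTop_add_const_left _ _ (Filter.tendsto_pow_atTop two_ne_zero)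

/-- The Fubini–Study area of the plane. -/
theorem lintegral_four_div_one_add_sq_norm_sq :
    ∫⁻ w : ℂ, ENNReal.ofReal (4 / (1 + ‖w‖ ^ 2) ^ 2) = ENNReal.ofReal (4 * Real.pi) := by
  have hpos : ∀ y ∈ Set.Ioi (0 : ℝ), 0 ≤ y * (4 / (1 + y ^ 2) ^ 2) := fun y hy => by
    have : (0 : ℝ) < y := hy
    positivity
  have hint := integrableOn_Ioi_deriv_of_nonneg'
    (fun y _ => hasDerivAt_neg_inv_one_add_sq y) hpos tendsto_neg_inv_one_add_sq
  have hval := integral_Ioi_of_hasDerivAt_of_nonneg'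
    (fun y _ => hasDerivAt_neg_inv_one_add_sq y) hpos tendsto_neg_inv_one_add_sq
  have hI : Integrable (fun w : ℂ => 4 / (1 + ‖w‖ ^ 2) ^ 2) := by
    refine (integrable_fun_norm_addHaar volume (E := ℂ)
      (f := fun y : ℝ => 4 / (1 + y ^ 2) ^ 2)).2 ?_
    simpa using hint
  rw [← ofReal_integral_eq_lintegral_ofReal hI
    (Filter.Eventually.of_forall fun w => by positivity),
    integral_fun_norm_addHaar volume (E := ℂ) (fun y : ℝ => 4 / (1 + y ^ 2) ^ 2)]
  congr 1
  simp only [Complex.finrank_real_complex, smul_eq_mul, Nat.add_one_sub_one, pow_one, hval]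
  simp [Measure.real, Complex.volume_ball]
  ring

/-! ### Generic fibres of a rational function -/

/-- For almost every `w`, the equation `P z / Q z = w` has exactly `max (deg P) (deg Q)`
solutions, none of them critical. -/
theorem Polynomial.ae_exists_card_fiber {P Q : ℂ[X]} (h : IsCoprime Q P)
    (hW : wronskian Q P ≠ 0) :
    ∀ᵐ w : ℂ, ∃ F : Finset ℂ, F.card = max P.natDegree Q.natDegree ∧ ∀ z, z ∈ F ↔
      (Q.eval z ≠ 0 ∧ (wronskian Q P).eval z ≠ 0) ∧ P.eval z / Q.eval z = w := by
  classical
  set d := max P.natDegree Q.natDegree with hd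
  have hcop : ∀ z, ¬ (P.eval z = 0 ∧ Q.eval z = 0) := by
    rintro z ⟨h1, h2⟩
    obtain ⟨a, b, hab⟩ := h
    have := congrArg (Polynomial.eval z) hab
    simp [h1, h2] at this
  -- Besides the critical values, the w for which the coefficient of degree d in P - wQ cancels is
  -- excluded. If `Q.coeff d = 0` no such w exists, and the quotient is 0 by convention, which is
  -- harmless to exclude.
  have hfin : (insert (P.coeff d / Q.coeff d)
      ((fun z => P.eval z / Q.eval z) '' {z | (wronskian Q P).IsRoot z})).Finite :=
    ((finite_setOfPred_isRoot hW).image _).insert _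
  refine hfin.countable.ae_notMem volume |>.mono ?_
  intro w hw
  rw [Set.mem_insert_iff, not_or] at hw
  obtain ⟨hw1, hw2⟩ := hw
  set R := P - C w * Q with hR
  have hev : ∀ z, R.eval z = P.eval z - w * Q.eval z := fun z => by simp [hR]
  have hcoeff : R.coeff d ≠ 0 := by
    rw [hR, coeff_sub, coeff_C_mul]
    intro h0
    by_cases hq : Q.coeff d = 0
    · have hp : P.coeff d = 0 := by simpa [hq] using h0
      rcases max_cases P.natDegree Q.natDegree with ⟨h1, h2⟩ | ⟨h1, h2⟩
      · rw [hd, h1] at hp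
        have : P = 0 := by simpa using hp
        exact hW (by simp [this, wronskian])
      · rw [hd, h1] at hq
        have : Q = 0 := by simpa using hq
        exact hW (by simp [this, wronskian])
    · exact hw1 (by field_simp; linear_combination -h0)
  have hR0 : R ≠ 0 := fun h0 => hcoeff (by simp [h0])
  have hdeg : R.natDegree = d := by
    refine le_antisymm ?_ (le_natDegree_of_ne_zero hcoeff)
    refine (natDegree_sub_le _ _).trans (max_le_max le_rfl (natDegree_C_mul_le _ _))
  have key : ∀ z, R.eval z = 0 →
      (Q.eval z ≠ 0 ∧ (wronskian Q P).eval z ≠ 0) ∧ P.eval z / Q.eval z = w := by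
    intro z hz
    rw [hev, sub_eq_zero] at hz
    have hq : Q.eval z ≠ 0 := fun hq => hcop z ⟨by simpa [hq] using hz, hq⟩
    have hzw : P.eval z / Q.eval z = w := by rw [hz]; field_simp
    exact ⟨⟨hq, fun hWz => hw2 ⟨z, hWz, hzw⟩⟩, hzw⟩
  -- The Wronskian QP' - Q'P equals QR' - Q'R, so it vanishes at a multiple root of R.
  have hnodup : R.roots.Nodup := by
    rw [Multiset.nodup_iff_count_le_one]
    intro z
    rw [count_roots]
    by_contra! hlt
    obtain ⟨h1, h2⟩ := (one_lt_rootMultiplicity_iff_isRoot hR0).1 hlt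
    refine (key z h1).1.2 ?_
    have h1' : P.eval z - w * Q.eval z = 0 := by rw [← hev]; exact h1
    have h2' : (derivative P).eval z - w * (derivative Q).eval z = 0 := by
      simpa [hR] using h2
    simp only [wronskian, eval_sub, eval_mul]
    linear_combination Q.eval z * h2' - (derivative Q).eval z * h1'
  refine ⟨R.roots.toFinset, ?_, fun z => ?_⟩
  · rw [Multiset.toFinset_card_of_nodup hnodup, ← hdeg]
    exact (IsAlgClosed.splits R).natDegree_eq_card_roots.symm
  · rw [Multiset.mem_toFinset, mem_roots hR0]
    refine ⟨key z, ?_⟩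
    rintro ⟨⟨hq, -⟩, hz⟩
    rw [IsRoot, hev, ← hz]
    field_simp
    ring

theorem Polynomial.hasStrictDerivAt_div {P Q : ℂ[X]} {z : ℂ} (hq : Q.eval z ≠ 0) :
    HasStrictDerivAt (fun z => P.eval z / Q.eval z)
      ((wronskian Q P).eval z / Q.eval z ^ 2) z := by
  convert! (P.hasStrictDerivAt z).fun_div (Q.hasStrictDerivAt z) hq using 1
  simp only [wronskian, eval_sub, eval_mul]
  ring

/-- The spherical area covered by a rational function, with multiplicity. -/
theorem Polynomial.lintegral_sphericalDensity {P Q : ℂ[X]} (h : IsCoprime Q P) :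
    ∫⁻ z : ℂ, ENNReal.ofReal (4 * ‖(wronskian Q P).eval z‖ ^ 2 /
      (‖P.eval z‖ ^ 2 + ‖Q.eval z‖ ^ 2) ^ 2) =
      (max P.natDegree Q.natDegree : ℕ) * ENNReal.ofReal (4 * Real.pi) := by
  -- For coprime P and Q this means that both are constant, and then both sides are 0.
  by_cases hW : wronskian Q P = 0
  · obtain ⟨h1, h2⟩ := h.wronskian_eq_zero_iff.1 hW
    simp [hW, derivative_eq_zero.1 h1,
      derivative_eq_zero.1 h2]
  have hQ0 : Q ≠ 0 := fun h0 => hW (by simp [h0, wronskian])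
  set U : Set ℂ := {z | Q.eval z ≠ 0 ∧ (wronskian Q P).eval z ≠ 0} with hU
  have hUm : MeasurableSet U :=
    ((isOpen_ne_fun Q.continuous continuous_const).inter
      (isOpen_ne_fun (wronskian Q P).continuous continuous_const)).measurableSet
  have hUae : ∀ᵐ z : ℂ, z ∈ U := by
    have h1 := (finite_setOfPred_isRoot hQ0).countable.ae_notMem volume
    have h2 := (finite_setOfPred_isRoot hW).countable.ae_notMem volume
    filter_upwards [h1, h2] with z hz1 hz2 using ⟨hz1, hz2⟩
  have hg : Measurable fun w : ℂ => ENNReal.ofReal (4 / (1 + ‖w‖ ^ 2) ^ 2) := by fun_prop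
  have := lintegral_comp_mul_sq_norm_deriv (U := U) hUm
    (fun z hz => hasStrictDerivAt_div (P := P) hz.1)
    (fun z hz => div_ne_zero hz.2 (pow_ne_zero 2 hz.1)) hg _ (ae_exists_card_fiber h hW)
  rw [lintegral_four_div_one_add_sq_norm_sq] at this
  rw [← this, ← setLIntegral_univ, ← setLIntegral_congr (s := U) (t := Set.univ) (by simpa)]
  refine setLIntegral_congr_fun hUm fun z hz => ?_
  rw [← ENNReal.ofReal_mul (by positivity)]
  have hq : ‖Q.eval z‖ ≠ 0 := norm_ne_zero_iff.2 hz.1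
  have hs : ‖P.eval z‖ ^ 2 + ‖Q.eval z‖ ^ 2 ≠ 0 := by positivity
  have hs' : ‖Q.eval z‖ ^ 2 + ‖P.eval z‖ ^ 2 ≠ 0 := by positivity
  congr 1
  rw [norm_div, norm_div, norm_pow]
  field_simp
  ring

/-! ### Regularity of the sphere map, including at poles -/

namespace SphereMap

theorem isCoprime_denom_num (f : RatFunc ℂ) : IsCoprime f.denom f.num :=
  (RatFunc.isCoprime_num_denom f).symm

theorem sq_norm_num_add_sq_norm_denom_pos (f : RatFunc ℂ) (z : ℂ) :
    0 < ‖f.num.eval z‖ ^ 2 + ‖f.denom.eval z‖ ^ 2 := by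
  by_cases hp : f.num.eval z = 0
  · have hq : f.denom.eval z ≠ 0 := by
      intro hq
      obtain ⟨a, b, hab⟩ := isCoprime_denom_num f
      have := congrArg (Polynomial.eval z) hab
      simp [hp, hq] at this
    positivity
  · positivity

theorem toVec_ofRat_of_denom_ne_zero (f : RatFunc ℂ) {z : ℂ} (hq : f.denom.eval z ≠ 0) :
    toVec (ofRat f) z = stereoVec (f.num.eval z / f.denom.eval z) := by
  simp only [toVec, ofRat, ratValue, if_neg hq]
  rfl

/-- In homogeneous coordinates `𝒮(f)` is given by one formula, also at the poles. -/
theorem toVec_ofRat (f : RatFunc ℂ) (z : ℂ) :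
    toVec (ofRat f) z = !₂[
      2 * (f.num.eval z * (starRingEnd ℂ) (f.denom.eval z)).re /
        (‖f.num.eval z‖ ^ 2 + ‖f.denom.eval z‖ ^ 2),
      2 * (f.num.eval z * (starRingEnd ℂ) (f.denom.eval z)).im /
        (‖f.num.eval z‖ ^ 2 + ‖f.denom.eval z‖ ^ 2),
      (‖f.num.eval z‖ ^ 2 - ‖f.denom.eval z‖ ^ 2) /
        (‖f.num.eval z‖ ^ 2 + ‖f.denom.eval z‖ ^ 2)] := by
  have hpos := sq_norm_num_add_sq_norm_denom_pos f z
  by_cases hq : f.denom.eval z = 0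
  · have : toVec (ofRat f) z = northVec := by
      simp only [toVec, ofRat, ratValue, if_pos hq]
      rfl
    rw [this, northVec]
    have hp : ‖f.num.eval z‖ ≠ 0 := by
      intro hp
      simp [hp, hq] at hpos
    simp [hq, hp]
  · rw [toVec_ofRat_of_denom_ne_zero f hq, stereoVec]
    generalize f.num.eval z = p at *
    generalize f.denom.eval z = q at *
    have hq' : ‖q‖ ≠ 0 := norm_ne_zero_iff.2 hq
    have hne := hpos.ne'
    have hne' : ‖q‖ ^ 2 + ‖p‖ ^ 2 ≠ 0 := by rwa [add_comm]
    have hdiv : p / q = ((‖q‖ ^ 2)⁻¹ : ℝ) * (p * (starRingEnd ℂ) q) := by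
      rw [div_eq_mul_inv, Complex.inv_def, Complex.sq_norm]
      ring
    have hre : (p / q).re = (p * (starRingEnd ℂ) q).re / ‖q‖ ^ 2 := by
      rw [hdiv, Complex.re_ofReal_mul]; ring
    have him : (p / q).im = (p * (starRingEnd ℂ) q).im / ‖q‖ ^ 2 := by
      rw [hdiv, Complex.im_ofReal_mul]; ring
    rw [hre, him, norm_div]
    congr 1
    ext i
    fin_cases i
    · simp only [Fin.zero_eta, Matrix.cons_val_zero]
      field_simp
      ring
    · simp only [Fin.mk_one, Matrix.cons_val_one, Matrix.cons_val_zero]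
      field_simp
      ring
    · simp only [Fin.reduceFinMk, Matrix.cons_val]
      field_simp

/-- The common denominator |P|² + |Q|² of the homogeneous formula never vanishes, by coprimality. -/
theorem contDiff_toVec_ofRat (f : RatFunc ℂ) : ContDiff ℝ 1 (toVec (ofRat f)) := by
  have hp : ContDiff ℝ 1 fun z : ℂ => f.num.eval z :=
    f.num.differentiable.contDiff.restrict_scalars ℝ
  have hq : ContDiff ℝ 1 fun z : ℂ => f.denom.eval z :=
    f.denom.differentiable.contDiff.restrict_scalars ℝ
  have hqc : ContDiff ℝ 1 fun z : ℂ => (starRingEnd ℂ) (f.denom.eval z) :=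
    Complex.conjCLE.contDiff.comp hq
  have hm := hp.mul hqc
  have hre : ContDiff ℝ 1 fun z : ℂ => (f.num.eval z * (starRingEnd ℂ) (f.denom.eval z)).re :=
    Complex.reCLM.contDiff.comp hm
  have him : ContDiff ℝ 1 fun z : ℂ => (f.num.eval z * (starRingEnd ℂ) (f.denom.eval z)).im :=
    Complex.imCLM.contDiff.comp hm
  have hn := (hp.norm_sq ℝ).add (hq.norm_sq ℝ)
  have hn0 := fun z => (sq_norm_num_add_sq_norm_denom_pos f z).ne'
  rw [contDiff_euclidean]
  intro i
  simp_rw [toVec_ofRat]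
  fin_cases i
  · exact (contDiff_const.mul hre).div hn hn0
  · exact (contDiff_const.mul him).div hn hn0
  · exact ((hp.norm_sq ℝ).sub (hq.norm_sq ℝ)).div hn hn0

/-! ### The density as a spherical Jacobian -/

theorem _root_.hasDerivAt_euclidean {ι : Type*} [Fintype ι] {γ : ℝ → EuclideanSpace ℝ ι}
    {v : EuclideanSpace ℝ ι} {t : ℝ} (h : ∀ i, HasDerivAt (fun s => γ s i) (v i) t) :
    HasDerivAt γ v t := by
  have := (PiLp.continuousLinearEquiv 2 ℝ (fun _ : ι => ℝ)).symm.hasFDerivAt.comp_hasDerivAt t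
    (hasDerivAt_pi.2 h)
  exact this

/-- The differential of the inverse stereographic projection. -/
theorem hasDerivAt_stereoVec {γ : ℝ → ℂ} {c : ℂ} {t : ℝ} (h : HasDerivAt γ c t) :
    HasDerivAt (fun s => stereoVec (γ s)) !₂[
      (2 * c.re * (1 + ‖γ t‖ ^ 2) - 4 * (γ t).re * ((γ t).re * c.re + (γ t).im * c.im)) /
        (1 + ‖γ t‖ ^ 2) ^ 2,
      (2 * c.im * (1 + ‖γ t‖ ^ 2) - 4 * (γ t).im * ((γ t).re * c.re + (γ t).im * c.im)) /
        (1 + ‖γ t‖ ^ 2) ^ 2,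
      4 * ((γ t).re * c.re + (γ t).im * c.im) / (1 + ‖γ t‖ ^ 2) ^ 2] t := by
  have ha : HasDerivAt (fun s => (γ s).re) c.re t := Complex.reCLM.hasFDerivAt.comp_hasDerivAt t h
  have hb : HasDerivAt (fun s => (γ s).im) c.im t := Complex.imCLM.hasFDerivAt.comp_hasDerivAt t h
  have hsq : ∀ z : ℂ, ‖z‖ ^ 2 = z.re ^ 2 + z.im ^ 2 := fun z => by
    rw [Complex.sq_norm, Complex.normSq_apply]; ring
  have hn : HasDerivAt (fun s => ‖γ s‖ ^ 2) (2 * ((γ t).re * c.re + (γ t).im * c.im)) t := by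
    simp_rw [hsq]
    convert! (ha.fun_pow 2).fun_add (hb.fun_pow 2) using 1
    push_cast
    ring
  have h0 : 1 + ‖γ t‖ ^ 2 ≠ 0 := by positivity
  have h0' : ‖γ t‖ ^ 2 + 1 ≠ 0 := by positivity
  refine hasDerivAt_euclidean fun i => ?_
  fin_cases i
  · convert! (ha.const_mul 2).fun_div (hn.const_add 1) h0 using 1
    simp only [Fin.zero_eta, Matrix.cons_val_zero]
    ring
  · convert! (hb.const_mul 2).fun_div (hn.const_add 1) h0 using 1
    simp only [Fin.mk_one, Matrix.cons_val_one, Matrix.cons_val_zero]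
    ring
  · convert! (hn.sub_const 1).fun_div (hn.add_const 1) h0' using 1
    simp only [Fin.reduceFinMk, Matrix.cons_val]
    ring

/-- The density of a conformal map: the spherical Jacobian of a holomorphic function. -/
theorem degreeDensity_eq_of_eventuallyEq {u : ℂ → S2} {f : ℂ → ℂ} {f' z : ℂ}
    (hu : DifferentiableAt ℝ (toVec u) z) (hf : HasDerivAt f f' z)
    (huf : toVec u =ᶠ[nhds z] fun w => stereoVec (f w)) :
    degreeDensity u z = 4 * ‖f'‖ ^ 2 / (1 + ‖f z‖ ^ 2) ^ 2 := by
  have hd : ∀ v : ℂ, fderiv ℝ (toVec u) z v = !₂[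
      (2 * (f' * v).re * (1 + ‖f z‖ ^ 2) -
        4 * (f z).re * ((f z).re * (f' * v).re + (f z).im * (f' * v).im)) /
        (1 + ‖f z‖ ^ 2) ^ 2,
      (2 * (f' * v).im * (1 + ‖f z‖ ^ 2) -
        4 * (f z).im * ((f z).re * (f' * v).re + (f z).im * (f' * v).im)) /
        (1 + ‖f z‖ ^ 2) ^ 2,
      4 * ((f z).re * (f' * v).re + (f z).im * (f' * v).im) / (1 + ‖f z‖ ^ 2) ^ 2] := by
    intro v
    -- The map is differentiated along the line through z in direction v in two ways, and the
    -- results agree by uniqueness.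
    have hl : HasDerivAt (fun t : ℝ => z + t * v) v 0 := by
      simpa using ((Complex.ofRealCLM.hasDerivAt (x := 0)).mul_const v).const_add z
    have hl0 : z + ((0 : ℝ) : ℂ) * v = z := by simp
    have hlc : Filter.Tendsto (fun t : ℝ => z + t * v) (nhds 0) (nhds z) := by
      simpa [hl0] using hl.continuousAt.tendsto
    have h1 : HasDerivAt (fun t : ℝ => toVec u (z + t * v)) (fderiv ℝ (toVec u) z v) 0 :=
      HasFDerivAt.comp_hasDerivAt_of_eq 0 hu.hasFDerivAt hl hl0.symm
    have h2 : HasDerivAt (fun t : ℝ => f (z + t * v)) (f' * v) 0 := by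
      have := HasFDerivAt.comp_hasDerivAt_of_eq 0 (hf.hasFDerivAt.restrictScalars ℝ) hl hl0.symm
      simpa [mul_comm, Function.comp_def] using this
    have h3 := hasDerivAt_stereoVec h2
    rw [hl0] at h3
    exact h1.unique (h3.congr_of_eventuallyEq (hlc.eventually huf))
  have hsq : ∀ z : ℂ, ‖z‖ ^ 2 = z.re ^ 2 + z.im ^ 2 := fun z => by
    rw [Complex.sq_norm, Complex.normSq_apply]; ring
  have hz : toVec u z = stereoVec (f z) := huf.self_of_nhds
  -- Projection from the north pole reverses the outward orientation, so the order `u_y × u_x` makes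
  -- the result nonnegative.
  rw [degreeDensity, derivX, derivY, hd, hd, hz, stereoVec]
  have h0 : 1 + ‖f z‖ ^ 2 ≠ 0 := by positivity
  have h0' : ‖f z‖ ^ 2 + 1 ≠ 0 := by positivity
  simp only [cross_apply, Matrix.vec3_dotProduct, Matrix.cons_val_zero, Matrix.cons_val_one,
    Matrix.cons_val, Complex.mul_re, Complex.mul_im, Complex.I_re, Complex.I_im, Complex.one_re,
    Complex.one_im, hsq f']
  field_simp
  rw [hsq]
  ring

theorem degreeDensity_ofRat_ae (f : RatFunc ℂ) :
    degreeDensity (ofRat f) =ᵐ[volume] fun z => 4 * ‖(wronskian f.denom f.num).eval z‖ ^ 2 /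
      (‖f.num.eval z‖ ^ 2 + ‖f.denom.eval z‖ ^ 2) ^ 2 := by
  have h1 := (finite_setOfPred_isRoot (RatFunc.denom_ne_zero f)).countable.ae_notMem volume
  filter_upwards [h1] with z hz
  replace hz : f.denom.eval z ≠ 0 := hz
  have hev : ∀ᶠ w in nhds z, f.denom.eval w ≠ 0 :=
    f.denom.continuous.continuousAt.eventually_ne hz
  rw [degreeDensity_eq_of_eventuallyEq
    ((contDiff_toVec_ofRat f).differentiable one_ne_zero z)
    (hasStrictDerivAt_div (P := f.num) hz).hasDerivAt
    (hev.mono fun w hw => toVec_ofRat_of_denom_ne_zero f hw), norm_div, norm_div, norm_pow]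
  have hq : ‖f.denom.eval z‖ ≠ 0 := norm_ne_zero_iff.2 hz
  have hs : ‖f.num.eval z‖ ^ 2 + ‖f.denom.eval z‖ ^ 2 ≠ 0 := by positivity
  have hs' : ‖f.denom.eval z‖ ^ 2 + ‖f.num.eval z‖ ^ 2 ≠ 0 := by positivity
  field_simp
  ring

/-! ### Degree formula and reduced fractions -/

/-- The degree of `𝒮(f)` is the degree of the rational function `f`. -/
theorem integrable_and_degree_ofRat (f : RatFunc ℂ) :
    Integrable (degreeDensity (ofRat f)) ∧
      degree (ofRat f) = (max f.num.natDegree f.denom.natDegree : ℕ) := by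
  have hae := degreeDensity_ofRat_ae f
  have hl := lintegral_sphericalDensity (isCoprime_denom_num f)
  have hnn : ∀ z, 0 ≤ 4 * ‖(wronskian f.denom f.num).eval z‖ ^ 2 /
      (‖f.num.eval z‖ ^ 2 + ‖f.denom.eval z‖ ^ 2) ^ 2 := fun z => by positivity
  have hmeas : AEStronglyMeasurable (fun z => 4 * ‖(wronskian f.denom f.num).eval z‖ ^ 2 /
      (‖f.num.eval z‖ ^ 2 + ‖f.denom.eval z‖ ^ 2) ^ 2) volume := by
    refine Measurable.aestronglyMeasurable ?_
    have := f.num.continuous.measurable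
    have := f.denom.continuous.measurable
    have := (wronskian f.denom f.num).continuous.measurable
    fun_prop
  refine ⟨(integrable_congr hae).2 ?_, ?_⟩
  · refine (lintegral_ofReal_ne_top_iff_integrable hmeas (Filter.Eventually.of_forall hnn)).1 ?_
    rw [hl]
    exact ENNReal.mul_ne_top (ENNReal.natCast_ne_top _) ENNReal.ofReal_ne_top
  · rw [degree, integral_congr_ae hae, integral_eq_lintegral_of_nonneg_ae
      (Filter.Eventually.of_forall hnn) hmeas, hl, ENNReal.toReal_mul, ENNReal.toReal_natCast,
      ENNReal.toReal_ofReal (by positivity)]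
    field_simp

/-- Cross-multiplying two reduced forms of the same fraction and using coprimality gives
divisibility both ways, so numerators and denominators agree up to units. -/
theorem max_natDegree_num_denom {p q : ℂ[X]} (hq : q ≠ 0) (h : IsCoprime p q) :
    max (algebraMap ℂ[X] (RatFunc ℂ) p / algebraMap ℂ[X] (RatFunc ℂ) q).num.natDegree
      (algebraMap ℂ[X] (RatFunc ℂ) p / algebraMap ℂ[X] (RatFunc ℂ) q).denom.natDegree =
      max p.natDegree q.natDegree := by
  set f := algebraMap ℂ[X] (RatFunc ℂ) p / algebraMap ℂ[X] (RatFunc ℂ) q with hf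
  have he : f.num * q = p * f.denom := (RatFunc.num_mul_eq_mul_denom_iff hq).2 hf
  have hc := RatFunc.isCoprime_num_denom f
  have h1 : Associated f.num p := associated_of_dvd_dvd
    (hc.dvd_of_dvd_mul_right ⟨q, he.symm⟩) (h.dvd_of_dvd_mul_right ⟨f.denom, he⟩)
  have h2 : Associated f.denom q := associated_of_dvd_dvd
    (hc.symm.dvd_of_dvd_mul_left ⟨p, by rw [he, mul_comm]⟩)
    (h.symm.dvd_of_dvd_mul_left ⟨f.num, by rw [← he, mul_comm]⟩)
  rw [natDegree_eq_of_degree_eq (degree_eq_degree_of_associated h1),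
    natDegree_eq_of_degree_eq (degree_eq_degree_of_associated h2)]

end SphereMap

/-- If g ≠ 0, the term gq dominates p and has degree at least that of q. If g = 0, its order counts
as 0 and q dominates. -/
theorem Polynomial.max_natDegree_mul_add {g p q : ℂ[X]} (h : p.natDegree < q.natDegree) :
    max (g * q + p).natDegree q.natDegree = g.natDegree + q.natDegree := by
  by_cases hg : g = 0
  · simp [hg, h.le]
  have hq : q ≠ 0 := by rintro rfl; simp at h
  have hm : (g * q).natDegree = g.natDegree + q.natDegree := natDegree_mul hg hq
  rw [natDegree_add_eq_left_of_natDegree_lt (by omega), hm]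
  omega

theorem proposition2 :
    (∀ g p q : Polynomial ℂ, p ≠ 0 → p.natDegree < q.natDegree → IsCoprime p q →
      ∀ u : ℂ → SphereMap.S2,
        u = SphereMap.ofRat (algebraMap (Polynomial ℂ) (RatFunc ℂ) g +
          algebraMap (Polynomial ℂ) (RatFunc ℂ) p / algebraMap (Polynomial ℂ) (RatFunc ℂ) q) →
        ContDiff ℝ 1 (SphereMap.toVec u) ∧
        MeasureTheory.Integrable (SphereMap.degreeDensity u) ∧
        SphereMap.degree u = (g.natDegree : ℝ) + (q.natDegree : ℝ)) ∧
    (∀ p q : Polynomial ℂ, p ≠ 0 → IsCoprime q p →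
      ∀ u : ℂ → SphereMap.S2,
        u = SphereMap.ofRat
          (algebraMap (Polynomial ℂ) (RatFunc ℂ) q / algebraMap (Polynomial ℂ) (RatFunc ℂ) p) →
        ContDiff ℝ 1 (SphereMap.toVec u) ∧
        MeasureTheory.Integrable (SphereMap.degreeDensity u) ∧
        SphereMap.degree u = ((max q.natDegree p.natDegree : ℕ) : ℝ)) := by
  refine ⟨?_, ?_⟩
  · rintro g p q - hlt hpq u rfl
    have hq : q ≠ 0 := by rintro rfl; simp at hlt
    have hsum : algebraMap (Polynomial ℂ) (RatFunc ℂ) g +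
        algebraMap (Polynomial ℂ) (RatFunc ℂ) p / algebraMap (Polynomial ℂ) (RatFunc ℂ) q =
        algebraMap (Polynomial ℂ) (RatFunc ℂ) (g * q + p) /
          algebraMap (Polynomial ℂ) (RatFunc ℂ) q := by
      have := RatFunc.algebraMap_ne_zero hq
      rw [map_add, map_mul]
      field_simp
    rw [hsum]
    have hc : IsCoprime (g * q + p) q := IsCoprime.mul_add_right_left hpq g
    refine ⟨SphereMap.contDiff_toVec_ofRat _, (SphereMap.integrable_and_degree_ofRat _).1, ?_⟩
    rw [(SphereMap.integrable_and_degree_ofRat _).2, SphereMap.max_natDegree_num_denom hq hc,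
      Polynomial.max_natDegree_mul_add hlt, Nat.cast_add]
  · rintro p q hp hqp u rfl
    refine ⟨SphereMap.contDiff_toVec_ofRat _, (SphereMap.integrable_and_degree_ofRat _).1, ?_⟩
    rw [(SphereMap.integrable_and_degree_ofRat _).2, SphereMap.max_natDegree_num_denom hp hqp]
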